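/- **Setting.** Let $\mathcal P=\{1,\dots,N\}$ and let $f_i:\mathbb R^n\to\mathbb R^n$, $i\in\mathcal P$, be locally Lipschitz vector fields with $f_i(0)=0$. Let $(\Omega,\mathfrak F,\mathsf P)$ be a probability space, and let $\sigma=(\sigma(t))_{t\ge0}$ be a càdlàg $\mathcal P$-valued process with $\sigma(0)$ deterministic and with random switching instants $0=\tau_0<\tau_1<\tau_2<\cdots$, such that $\sigma$ is constant on each interval $[\tau_i,\tau_{i+1})$ (the possibility $\sigma(\tau_{i+1})=\sigma(\tau_i)$ is allowed). Consider the randomly switched system $$\dot x=f_{\sigma}(x),\qquad x(0)=x_0,\quad t\ge 0,$$ whose solutions are understood in the sense of Carathéodory (absolutely continuous on compact intervals, equation satisfied for almost every $t$). **Theorem.** Assume the following. * (U1) There are $C^1$ functions $V_i:\mathbb R^n\to\mathbb R$, functions $\alpha_1,\alpha_2$ of class $\mathcal K_\infty$ (continuous, strictly increasing, unbounded on $[0,\infty)$, vanishing at $0$), and numbers $\mu>1$, $\lambda_i\in\mathbb R$ ($i\in\mathcal P$) such that for all $x\in\mathbb R^n$ and $i,j\in\mathcal P$: $\alpha_1(\|x\|)\le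 V_i(x)\le\alpha_2(\|x\|)$; $\langle\nabla V_i(x),f_i(x)\rangle\le-\lambda_iV_i(x)$; and $V_i(x)\le\mu V_j(x)$. * (U2) The holding times $S_i=\tau_i-\tau_{i-1}$, $i\ge1$, are i.i.d. and uniformly distributed on $[0,T]$, $T>0$; there are $q_i\in[0,1]$ with $\mathsf P\bigl(\sigma(\tau_j)=i\,\big|\,\sigma(\tau_0),\dots,\sigma(\tau_{j-1})\bigr)=q_i$ a.s. for all $j\ge1$, $i\in\mathcal P$; and the sequences $(S_i)_{i\ge1}$ and $(\sigma(\tau_i))_{i\ge0}$ are independent. * (U3) $\displaystyle\sum_{i\in\mathcal P}\mu q_i\,\frac{1-e^{-\lambda_iT}}{\lambda_iT}<1$, where the quotient is read as its limit $1$ if $\lambda_i=0$. Then almost surely, for every $x_0\in\mathbb R^n$, the switched system has a unique global solution $x(\cdot)$ on $[0,\infty)$ with $x(0)=x_0$, and the system is globally asymptotically stable almost surely, that is: * (AS1) almost surely, for every $\varepsilon>0$ there is $\delta>0$ such that every solution with $\|x_0\|<\delta$ satisfies $\sup_{t\ge0}\|x(t)\|<\varepsilon$; * (AS2) almost surely,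 for all $r,\varepsilon'>0$ there is $T'\ge0$ such that every solution with $\|x_0\|<r$ satisfies $\sup_{t\ge T'}\|x(t)\|<\varepsilon'$. -/

import Mathlib

open MeasureTheory ProbabilityTheory Set Filter Topology
open scoped ENNReal

noncomputable section

namespace SwitchedSystem

/-- The state space `ℝⁿ` with its Euclidean norm. -/
abbrev State (n : ℕ) : Type := EuclideanSpace ℝ (Fin n)

/-- Class `K_∞`: continuous, strictly increasing and unbounded functions `[0, ∞) → [0, ∞)`
vanishing at `0` (only the values on `[0, ∞)` matter). -/
structure ClassKInf (α : ℝ → ℝ) : Prop where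
  continuousOn : ContinuousOn α (Ici 0)
  map_zero : α 0 = 0
  strictMonoOn : StrictMonoOn α (Ici 0)
  unbounded : Tendsto α atTop atTop

/-- The standing hypotheses on the subsystems `x' = f i x`. -/
structure IsSubsystemFamily {n N : ℕ} (f : Fin N → State n → State n) : Prop where
  locallyLipschitz : ∀ i, LocallyLipschitz (f i)
  map_zero : ∀ i, f i 0 = 0

/-- The multiple Lyapunov function hypotheses. -/
structure IsLyapunovFamily {n N : ℕ} (f : Fin N → State n → State n) (V : Fin N → State n → ℝ)
    (α₁ α₂ : ℝ → ℝ) (μ : ℝ) (lam : Fin N → ℝ) : Prop where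
  contDiff : ∀ i, ContDiff ℝ 1 (V i)
  classKInf_lower : ClassKInf α₁
  classKInf_upper : ClassKInf α₂
  one_lt : 1 < μ
  lower_bound : ∀ i x, α₁ ‖x‖ ≤ V i x
  upper_bound : ∀ i x, V i x ≤ α₂ ‖x‖
  lieDeriv_le : ∀ i x, inner ℝ (gradient (V i) x) (f i x) ≤ -lam i * V i x
  comparable : ∀ i j x, V i x ≤ μ * V j x

/-- A path `s` (considered on `[0, ∞)`) of a switching signal with switching instants
`t 0 = 0 < t 1 < t 2 < ⋯`: it is càdlàg and constant on every `[t i, t (i + 1))`.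
It is allowed that `s (t (i + 1)) = s (t i)`. -/
structure IsSwitchingPath {N : ℕ} (s : ℝ → Fin N) (t : ℕ → ℝ) : Prop where
  rightCts : ∀ u, 0 ≤ u → ContinuousWithinAt s (Ici u) u
  leftLim : ∀ u, 0 < u → ∃ l, Tendsto s (𝓝[<] u) (𝓝 l)
  zero : t 0 = 0
  strictMono : StrictMono t
  const : ∀ i, ∀ u ∈ Ico (t i) (t (i + 1)), s u = s (t i)

variable {Ω : Type*} [MeasurableSpace Ω]

/-- The holding times `S_{i+1} = τ_{i+1} - τ_i`, indexed by `i = 0, 1, 2, …`. -/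
def holdingTime (τ : ℕ → Ω → ℝ) (i : ℕ) (ω : Ω) : ℝ := τ (i + 1) ω - τ i ω

/-- The jump destinations `σ(τ_i)`. -/
def destination {N : ℕ} (σ : ℝ → Ω → Fin N) (τ : ℕ → Ω → ℝ) (i : ℕ) (ω : Ω) : Fin N :=
  σ (τ i ω) ω

/-- `σ = (σ(t))_{t ≥ 0}` is a random switching signal with deterministic initial value and
switching instants `τ`. -/
structure IsSwitchingSignal {N : ℕ} (P : Measure Ω) (σ : ℝ → Ω → Fin N) (τ : ℕ → Ω → ℝ) :
    Prop where
  measurable_signal : ∀ t, 0 ≤ t → Measurable (σ t)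
  measurable_times : ∀ i, Measurable (τ i)
  measurable_destination : ∀ i, Measurable (destination σ τ i)
  initial : ∃ i₀, ∀ᵐ ω ∂P, σ 0 ω = i₀
  paths : ∀ᵐ ω ∂P, IsSwitchingPath (fun t => σ t ω) (fun i => τ i ω)

/-- The class UH: i.i.d. uniform holding times on `[0, T]`; destinations which, conditionally on
all previous ones, have the distribution `q`; the holding times are independent of the
destinations. -/
structure ClassUH {N : ℕ} (P : Measure Ω) (σ : ℝ → Ω → Fin N) (τ : ℕ → Ω → ℝ) (T : ℝ)
    (q : Fin N → ℝ) : Prop where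
  pos : 0 < T
  uniform : ∀ i, pdf.IsUniform (holdingTime τ i) (Icc 0 T) P
  indep_times : iIndepFun (fun i => holdingTime τ i) P
  mem_Icc : ∀ i, q i ∈ Icc (0 : ℝ) 1
  condProb : ∀ j, 1 ≤ j → ∀ i : Fin N,
    P⟦destination σ τ j ⁻¹' {i} |
      MeasurableSpace.comap (fun ω (k : Fin j) => destination σ τ k ω) inferInstance⟧
      =ᵐ[P] fun _ => q i
  indep : IndepFun (fun ω i => holdingTime τ i ω) (fun ω i => destination σ τ i ω) P

/-- `x` (considered on `[0, ∞)`) is a global Carathéodory solution of `x' = f_{s(t)}(x)`,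
`x(0) = x₀`: it is absolutely continuous on compact intervals and satisfies the equation at
almost every time. -/
structure IsSolution {n N : ℕ} (f : Fin N → State n → State n) (s : ℝ → Fin N) (x₀ : State n)
    (x : ℝ → State n) : Prop where
  initial : x 0 = x₀
  absCont : ∀ b, 0 < b → AbsolutelyContinuousOnInterval x 0 b
  ode : ∀ᵐ t ∂(volume.restrict (Ioi (0 : ℝ))), HasDerivAt x (f (s t) (x t)) t

/-- Almost surely, for every initial state the switched system has a global solution, and this
solution is unique. -/
def WellPosedAS {n N : ℕ} (P : Measure Ω) (f : Fin N → State n → State n)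
    (σ : ℝ → Ω → Fin N) : Prop :=
  ∀ᵐ ω ∂P, ∀ x₀ : State n, ∃ x, IsSolution f (fun t => σ t ω) x₀ x ∧
    ∀ y, IsSolution f (fun t => σ t ω) x₀ y → EqOn y x (Ici 0)

/-- Global asymptotic stability almost surely. The suprema are taken in `[0, ∞]`, so that they
are meaningful for unbounded paths as well. -/
structure GASAlmostSurely {n N : ℕ} (P : Measure Ω) (f : Fin N → State n → State n)
    (σ : ℝ → Ω → Fin N) : Prop where
  stable : ∀ᵐ ω ∂P, ∀ ε : ℝ, 0 < ε → ∃ δ : ℝ, 0 < δ ∧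
    ∀ (x₀ : State n) (x : ℝ → State n), IsSolution f (fun t => σ t ω) x₀ x → ‖x₀‖ < δ →
      (⨆ t ∈ Ici (0 : ℝ), ‖x t‖ₑ) < ENNReal.ofReal ε
  attractive : ∀ᵐ ω ∂P, ∀ r ε : ℝ, 0 < r → 0 < ε → ∃ T : ℝ, 0 ≤ T ∧
    ∀ (x₀ : State n) (x : ℝ → State n), IsSolution f (fun t => σ t ω) x₀ x → ‖x₀‖ < r →
      (⨆ t ∈ Ici T, ‖x t‖ₑ) < ENNReal.ofReal ε

/-- The function `a ↦ (1 - e^{-a}) / a`, extended continuously by the value `1` at `a = 0`. -/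
def expRatio (a : ℝ) : ℝ := if a = 0 then 1 else (1 - Real.exp (-a)) / a

end SwitchedSystem

end

/-! The argument separates a pathwise estimate from a probabilistic one. Along a fixed switching
path, V of the active mode changes by at most `exp (-lam i * S)` during a holding time S and by at
most μ at a switch. Hence α₁‖x(u)‖ is bounded by a constant times M_k α₂‖x₀‖, where M_k
(`growthFactor`) is the product of these factors up to the last switch before u. Holding times are
at most T, so one constant covers every interval, even for unstable modes. If M_k → 0, boundedness
of M_k gives stability and its limit gives attractivity, uniformly on balls.

That M_k → 0 almost surely follows from first moments (`ClassUH.ae_tendsto_prod_exp`). Integrating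
out the holding times, which are independent of the destinations, replaces each factor by a_i = μ *
expRatio (lam i * T). Conditioning on past destinations then peels off one factor θ = ∑ a_i q_i at a
time. Since θ < 1, the expectations are summable, so ∑ M_k is almost surely finite.

The same result with μ and all rates replaced by 1 reads exp(-τ_k) → 0: switching instants do not
accumulate. Global solutions are then concatenations of local ones, and V excludes blow-up within
each mode. -/

noncomputable section

namespace SwitchedSystem

/-! ### Autonomous equations: regularity, uniqueness, existence for bounded fields -/

section ODE

variable {E : Type*} [NormedAddCommGroup E] [NormedSpace ℝ E]

/-- An absolutely continuous curve which satisfies an autonomous equation with continuous right-hand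
side almost everywhere satisfies it everywhere. -/
theorem hasDerivWithinAt_of_absolutelyContinuous [CompleteSpace E] {x : ℝ → E} {g : E → E}
    {a b : ℝ} (hab : a < b) (hx : AbsolutelyContinuousOnInterval x a b) (hg : Continuous g)
    (hd : ∀ᵐ t, t ∈ Ioo a b → HasDerivAt x (g (x t)) t) :
    ∀ t ∈ Icc a b, HasDerivWithinAt x (g (x t)) (Icc a b) t := by
  have hxc : ContinuousOn x (Icc a b) := by
    simpa [uIcc_of_le hab.le] using hx.continuousOn
  -- The continuous extension G of g ∘ x has a C¹ primitive z on all of ℝ; x - z is absolutely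
  -- continuous with derivative zero almost everywhere, hence constant.
  obtain ⟨G, hGc, hGx⟩ : ∃ G : ℝ → E, Continuous G ∧ ∀ t ∈ Icc a b, G t = g (x t) :=
    ⟨IccExtend hab.le ((Icc a b).domRestrict (fun t => g (x t))),
      Continuous.Icc_extend'
        (continuousOn_iff_continuous_domRestrict.1 (hg.comp_continuousOn hxc)),
      fun t ht => by rw [IccExtend_of_mem hab.le _ ht]; rfl⟩
  obtain ⟨z, hz⟩ : ∃ z : ℝ → E, z = fun t => ∫ u in a..t, G u := ⟨_, rfl⟩
  have hzd : ∀ t, HasDerivAt z (G t) t := fun t => by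
    rw [hz]; exact (hGc.integral_hasStrictDerivAt a t).hasDerivAt
  have hzac : AbsolutelyContinuousOnInterval z a b := by
    obtain ⟨C, hC⟩ := isCompact_Icc.exists_bound_of_continuousOn (hGc.continuousOn (s := Icc a b))
    have hL : LipschitzOnWith C.toNNReal z (uIcc a b) := by
      rw [uIcc_of_le hab.le]
      refine (convex_Icc a b).lipschitzOnWith_of_nnnorm_hasDerivWithin_le
        (fun t _ => (hzd t).hasDerivWithinAt) fun t ht => ?_
      rw [← NNReal.coe_le_coe, coe_nnnorm]
      exact (hC t ht).trans (Real.le_coe_toNNReal C)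
    exact hL.absolutelyContinuousOnInterval
  obtain ⟨C, hC⟩ := (hx.sub hzac).const_of_ae_hasDerivAt_zero (by
    have h1 : ∀ᵐ t : ℝ, t ≠ a := by simp [ae_iff]
    have h2 : ∀ᵐ t : ℝ, t ≠ b := by simp [ae_iff]
    filter_upwards [hd, h1, h2] with t ht hta htb htI
    rw [uIcc_of_le hab.le] at htI
    have := (ht ⟨lt_of_le_of_ne htI.1 hta.symm, lt_of_le_of_ne htI.2 htb⟩).sub (hzd t)
    rwa [hGx t htI, sub_self] at this)
  rw [uIcc_of_le hab.le] at hC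
  have hxz : ∀ t ∈ Icc a b, x t = z t + C := fun t ht => by
    rw [← hC t ht]; simp
  intro t ht
  rw [← hGx t ht]
  exact ((hzd t).add_const C).hasDerivWithinAt.congr hxz (hxz t ht)

/-- A locally Lipschitz map is Lipschitz on every closed ball of a proper space. -/
theorem _root_.LocallyLipschitz.exists_lipschitzOnWith_closedBall {X Y : Type*}
    [PseudoMetricSpace X] [ProperSpace X] [PseudoMetricSpace Y] {g : X → Y}
    (hg : LocallyLipschitz g) (c : X) (r : ℝ) :
    ∃ K, LipschitzOnWith K g (Metric.closedBall c r) :=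
  (hg.locallyLipschitzOn (s := Metric.closedBall c r)).exists_lipschitzOnWith_of_compact
    (isCompact_closedBall c r)

theorem hasDerivWithinAt_Ici_of_Icc {x : ℝ → E} {x' : E} {a b t : ℝ} (ht : t ∈ Ico a b)
    (h : HasDerivWithinAt x x' (Icc a b) t) : HasDerivWithinAt x x' (Ici t) t :=
  h.mono_of_mem_nhdsWithin
    (mem_of_superset (Icc_mem_nhdsGE ht.2) (Icc_subset_Icc_left ht.1))

/-- Solutions of an autonomous locally Lipschitz equation are determined by their initial value. -/
theorem eqOn_Icc_of_hasDerivWithinAt [ProperSpace E] {g : E → E} (hg : LocallyLipschitz g)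
    {x y : ℝ → E} {a b : ℝ}
    (hx : ∀ t ∈ Icc a b, HasDerivWithinAt x (g (x t)) (Icc a b) t)
    (hy : ∀ t ∈ Icc a b, HasDerivWithinAt y (g (y t)) (Icc a b) t) (hxy : x a = y a) :
    EqOn x y (Icc a b) := by
  have hxc : ContinuousOn x (Icc a b) := fun t ht => (hx t ht).continuousWithinAt
  have hyc : ContinuousOn y (Icc a b) := fun t ht => (hy t ht).continuousWithinAt
  obtain ⟨R₁, hR₁⟩ := (isCompact_Icc.image_of_continuousOn hxc).isBounded.subset_closedBall 0
  obtain ⟨R₂, hR₂⟩ := (isCompact_Icc.image_of_continuousOn hyc).isBounded.subset_closedBall 0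
  obtain ⟨K, hK⟩ := hg.exists_lipschitzOnWith_closedBall (0 : E) (max R₁ R₂)
  refine ODE_solution_unique_of_mem_Icc_right (v := fun _ => g)
    (s := fun _ => Metric.closedBall 0 (max R₁ R₂)) (fun _ _ => hK) hxc
    (fun t ht => hasDerivWithinAt_Ici_of_Icc ht (hx t (Ico_subset_Icc_self ht)))
    (fun t ht => ?_) hyc
    (fun t ht => hasDerivWithinAt_Ici_of_Icc ht (hy t (Ico_subset_Icc_self ht)))
    (fun t ht => ?_) hxy
  · exact Metric.closedBall_subset_closedBall (le_max_left _ _)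
      (hR₁ (mem_image_of_mem x (Ico_subset_Icc_self ht)))
  · exact Metric.closedBall_subset_closedBall (le_max_right _ _)
      (hR₂ (mem_image_of_mem y (Ico_subset_Icc_self ht)))

/-- A bounded, locally Lipschitz vector field on a proper space has solutions on every interval. -/
theorem exists_hasDerivWithinAt_of_bounded [ProperSpace E] [CompleteSpace E] {g : E → E}
    (hg : LocallyLipschitz g) {C : ℝ} (hC : ∀ y, ‖g y‖ ≤ C) (x₀ : E) {a b : ℝ} (hab : a ≤ b) :
    ∃ x : ℝ → E, x a = x₀ ∧ ∀ t ∈ Icc a b, HasDerivWithinAt x (g (x t)) (Icc a b) t := by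
  have hC0 : 0 ≤ C := (norm_nonneg _).trans (hC x₀)
  -- At speed at most C a solution moves at most C * (b - a), so on this ball Picard–Lindelöf covers
  -- all of [a, b] at once.
  obtain ⟨K, hK⟩ := hg.exists_lipschitzOnWith_closedBall x₀ (C * (b - a))
  have hr : 0 ≤ C * (b - a) := mul_nonneg hC0 (sub_nonneg.2 hab)
  have hpl : IsPicardLindelof (fun _ => g) (⟨a, left_mem_Icc.2 hab⟩ : Icc a b) x₀
      ⟨C * (b - a), hr⟩ 0 ⟨C, hC0⟩ K :=
    { lipschitzOnWith := fun _ _ => hK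
      continuousOn := fun _ _ => continuousOn_const
      norm_le := fun _ _ y _ => hC y
      mul_max_le := by
        simp only [sub_self, NNReal.coe_zero, sub_zero]
        rw [max_eq_left (sub_nonneg.2 hab)]
        exact le_rfl }
  exact hpl.exists_eq_forall_mem_Icc_hasDerivWithinAt₀

end ODE

/-! ### Lyapunov decay along a flow and absence of blow-up -/

section Lyapunov

variable {E : Type*} [NormedAddCommGroup E] [InnerProductSpace ℝ E] [CompleteSpace E]

/-- The comparison principle for a Lyapunov function along a solution. -/
theorem lyapunov_le_exp_mul {W : E → ℝ} (hW : Differentiable ℝ W) {g : E → E} {l : ℝ}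
    (hl : ∀ y, inner ℝ (gradient W y) (g y) ≤ -l * W y) {x : ℝ → E} {a b : ℝ}
    (hx : ∀ t ∈ Icc a b, HasDerivWithinAt x (g (x t)) (Icc a b) t) {t : ℝ} (ht : t ∈ Icc a b) :
    W (x t) ≤ Real.exp (-l * (t - a)) * W (x a) := by
  -- The weight exp(l(u - a)) turns the differential inequality into monotonicity of a single
  -- function.
  have hd : ∀ u ∈ Ioo a b, HasDerivAt (fun u => Real.exp (l * (u - a)) * W (x u))
      (Real.exp (l * (u - a)) * l * W (x u) +
        Real.exp (l * (u - a)) * inner ℝ (gradient W (x u)) (g (x u))) u := by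
    intro u hu
    have h1 : HasDerivAt x (g (x u)) u :=
      (hx u (Ioo_subset_Icc_self hu)).hasDerivAt (Icc_mem_nhds hu.1 hu.2)
    have h2 := (hW (x u)).hasGradientAt.hasFDerivAt.comp_hasDerivAt u h1
    have h3 : HasDerivAt (fun u => Real.exp (l * (u - a))) (Real.exp (l * (u - a)) * l) u := by
      simpa using (((hasDerivAt_id u).sub_const a).const_mul l).exp
    have h4 := h3.mul h2
    rwa [InnerProductSpace.toDual_apply_apply] at h4
  have hc : ContinuousOn (fun u => Real.exp (l * (u - a)) * W (x u)) (Icc a b) :=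
    ContinuousOn.mul (by fun_prop)
      (hW.continuous.comp_continuousOn fun u hu => (hx u hu).continuousWithinAt)
  have hanti := antitoneOn_of_deriv_nonpos (convex_Icc a b) hc
    (fun u hu => (hd u (by simpa using hu)).differentiableAt.differentiableWithinAt)
    (fun u hu => by
      rw [(hd u (by simpa using hu)).deriv, mul_assoc, ← mul_add]
      exact mul_nonpos_of_nonneg_of_nonpos (Real.exp_pos _).le (by linarith [hl (x u)]))
  have h := hanti (left_mem_Icc.2 (ht.1.trans ht.2)) ht ht.1
  simp only [sub_self, mul_zero, Real.exp_zero, one_mul] at h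
  calc W (x t) = Real.exp (-l * (t - a)) * (Real.exp (l * (t - a)) * W (x t)) := by
        rw [← mul_assoc, ← Real.exp_add]; simp
    _ ≤ _ := mul_le_mul_of_nonneg_left h (Real.exp_pos _).le

/-- A locally Lipschitz vector field with a proper Lyapunov function of at most exponential growth
has solutions on every interval. -/
theorem exists_hasDerivWithinAt_of_lyapunov [ProperSpace E] {g : E → E} (hg : LocallyLipschitz g)
    {W : E → ℝ} (hW : Differentiable ℝ W) (hW0 : ∀ y, 0 ≤ W y) {α : ℝ → ℝ}
    (hα : ClassKInf α) (hαW : ∀ y, α ‖y‖ ≤ W y) {l : ℝ}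
    (hl : ∀ y, inner ℝ (gradient W y) (g y) ≤ -l * W y) (x₀ : E) {a b : ℝ} (hab : a ≤ b) :
    ∃ x : ℝ → E, x a = x₀ ∧ ∀ t ∈ Icc a b, HasDerivWithinAt x (g (x t)) (Icc a b) t := by
  -- α R dominates every value W can reach on [a, b] at growth rate |l|. The field is cut off
  -- outside radius R; its solution never leaves that ball, so it solves the original equation.
  obtain ⟨R, hR, hR0⟩ := ((hα.unbounded.eventually_ge_atTop
    (Real.exp (|l| * (b - a)) * W x₀)).and (eventually_ge_atTop 0)).exists
  set χ : E → ℝ := fun y => max 0 (min 1 (R + 1 - ‖y‖)) with hχ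
  have hχ0 : ∀ y, 0 ≤ χ y := fun y => le_max_left _ _
  have hχ1 : ∀ y, χ y ≤ 1 := fun y => max_le zero_le_one (min_le_left _ _)
  have hχR : ∀ y, ‖y‖ ≤ R → χ y = 1 := fun y hy => by
    simp only [hχ]; rw [min_eq_left (by linarith), max_eq_right zero_le_one]
  have hχR1 : ∀ y, R + 1 ≤ ‖y‖ → χ y = 0 := fun y hy => by
    simp only [hχ]; rw [max_eq_left ((min_le_right _ _).trans (by linarith))]
  have hχL : LocallyLipschitz χ :=
    ((LocallyLipschitz.const (R + 1)).sub lipschitzWith_one_norm.locallyLipschitz).const_min 1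
      |>.const_max 0
  have hsm : LocallyLipschitz fun y => χ y • g y := by
    have h1 : LocallyLipschitz fun p : ℝ × E => p.1 • p.2 :=
      ContDiff.locallyLipschitz (𝕂 := ℝ) (contDiff_fst.smul contDiff_snd)
    exact h1.comp (hχL.prodMk hg)
  obtain ⟨C, hC⟩ := (isCompact_closedBall (0 : E) (R + 1)).exists_bound_of_continuousOn
    hg.continuous.continuousOn
  have hbd : ∀ y, ‖χ y • g y‖ ≤ max C 0 := fun y => by
    rcases le_total (R + 1) ‖y‖ with h | h
    · simp [hχR1 y h]
    · rw [norm_smul, Real.norm_of_nonneg (hχ0 y)]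
      exact (mul_le_of_le_one_left (norm_nonneg _) (hχ1 y)).trans
        ((hC y (by simpa using h)).trans (le_max_left _ _))
  obtain ⟨x, hx0, hx⟩ := exists_hasDerivWithinAt_of_bounded hsm hbd x₀ hab
  -- Cutting off can destroy decay, so only growth at rate |l| is claimed; this holds for either
  -- sign of l.
  have hl' : ∀ y, inner ℝ (gradient W y) (χ y • g y) ≤ -(-|l|) * W y := fun y => by
    rw [inner_smul_right, neg_neg]
    calc χ y * inner ℝ (gradient W y) (g y) ≤ χ y * (|l| * W y) :=
          mul_le_mul_of_nonneg_left ((hl y).trans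
            (mul_le_mul_of_nonneg_right (neg_le_abs l) (hW0 y))) (hχ0 y)
      _ ≤ |l| * W y := mul_le_of_le_one_left (mul_nonneg (abs_nonneg _) (hW0 y)) (hχ1 y)
  refine ⟨x, hx0, fun t ht => ?_⟩
  have hxR : ‖x t‖ ≤ R := by
    have h1 : α ‖x t‖ ≤ α R := by
      refine (hαW _).trans ((lyapunov_le_exp_mul hW hl' hx ht).trans (le_trans ?_ hR))
      rw [neg_neg, hx0]
      exact mul_le_mul_of_nonneg_right (Real.exp_le_exp.2
        (mul_le_mul_of_nonneg_left (by linarith [ht.2]) (abs_nonneg l))) (hW0 _)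
    exact (hα.strictMonoOn.le_iff_le (norm_nonneg _) hR0).1 h1
  simpa [hχR _ hxR] using hx t ht

end Lyapunov

/-! ### Solutions along a fixed switching path -/

section Path

variable {n N : ℕ} {f : Fin N → State n → State n} {s : ℝ → Fin N} {t : ℕ → ℝ}
  {V : Fin N → State n → ℝ} {α₁ α₂ : ℝ → ℝ} {μ : ℝ} {lam : Fin N → ℝ}

theorem ClassKInf.nonneg {α : ℝ → ℝ} (hα : ClassKInf α) {r : ℝ} (hr : 0 ≤ r) : 0 ≤ α r := by
  rw [← hα.map_zero]
  exact hα.strictMonoOn.monotoneOn self_mem_Ici hr hr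

theorem IsLyapunovFamily.nonneg (hV : IsLyapunovFamily f V α₁ α₂ μ lam) (i : Fin N)
    (y : State n) : 0 ≤ V i y :=
  (hV.classKInf_lower.nonneg (norm_nonneg y)).trans (hV.lower_bound i y)

theorem IsLyapunovFamily.differentiable (hV : IsLyapunovFamily f V α₁ α₂ μ lam) (i : Fin N) :
    Differentiable ℝ (V i) := (hV.contDiff i).differentiable one_ne_zero

theorem IsSwitchingPath.nonneg (hs : IsSwitchingPath s t) (k : ℕ) : 0 ≤ t k := by
  rw [← hs.zero]
  exact hs.strictMono.monotone (Nat.zero_le k)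

theorem IsSwitchingPath.lt_succ (hs : IsSwitchingPath s t) (k : ℕ) : t k < t (k + 1) :=
  hs.strictMono (Nat.lt_succ_self k)

theorem IsSwitchingPath.exists_mem_Ico (hs : IsSwitchingPath s t) (ht : Tendsto t atTop atTop)
    {u : ℝ} (hu : 0 ≤ u) : ∃ k, u ∈ Ico (t k) (t (k + 1)) := by
  classical
  have h : ∃ k, u < t k := (ht.eventually_gt_atTop u).exists
  obtain ⟨k, hk⟩ : ∃ k, Nat.find h = k + 1 := Nat.exists_eq_succ_of_ne_zero fun h0 => by
    have := Nat.find_spec h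
    rw [h0, hs.zero] at this
    exact this.not_ge hu
  refine ⟨k, not_lt.1 (Nat.find_min h (by omega)), hk ▸ Nat.find_spec h⟩

theorem IsSwitchingPath.eq_of_mem_Ico (hs : IsSwitchingPath s t) {u : ℝ} {k l : ℕ}
    (hk : u ∈ Ico (t k) (t (k + 1))) (hl : u ∈ Ico (t l) (t (l + 1))) : k = l := by
  have h1 := hs.strictMono.lt_iff_lt.1 (hk.1.trans_lt hl.2)
  have h2 := hs.strictMono.lt_iff_lt.1 (hl.1.trans_lt hk.2)
  omega

/-- Between two switching instants a Carathéodory solution is a classical solution. -/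
theorem IsSolution.hasDerivWithinAt (hf : IsSubsystemFamily f) (hs : IsSwitchingPath s t)
    {x₀ : State n} {x : ℝ → State n} (hx : IsSolution f s x₀ x) (k : ℕ) :
    ∀ u ∈ Icc (t k) (t (k + 1)),
      HasDerivWithinAt x (f (s (t k)) (x u)) (Icc (t k) (t (k + 1))) u := by
  have h0 := hs.nonneg k
  have h1 := hs.lt_succ k
  refine hasDerivWithinAt_of_absolutelyContinuous h1
    ((hx.absCont (t (k + 1)) (h0.trans_lt h1)).mono ?_) (hf.locallyLipschitz _).continuous ?_
  · rw [uIcc_of_le h1.le, uIcc_of_le (h0.trans h1.le)]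
    exact Icc_subset_Icc_left h0
  · filter_upwards [(ae_restrict_iff' measurableSet_Ioi).1 hx.ode] with u hu huI
    rw [← hs.const k u (Ioo_subset_Ico_self huI)]
    exact hu (h0.trans_lt huI.1)

/-- A curve on `[0, ∞)` which is a classical solution between any two consecutive switching
instants is a Carathéodory solution. -/
theorem isSolution_of_hasDerivWithinAt (hf : IsSubsystemFamily f) (hs : IsSwitchingPath s t)
    (ht : Tendsto t atTop atTop) {x₀ : State n} {x : ℝ → State n} (hx0 : x 0 = x₀)
    (hx : ∀ k, ∀ u ∈ Icc (t k) (t (k + 1)),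
      HasDerivWithinAt x (f (s (t k)) (x u)) (Icc (t k) (t (k + 1))) u) :
    IsSolution f s x₀ x := by
  have hc : ∀ k, ContinuousOn x (Icc 0 (t k)) := fun k => by
    induction k with
    | zero => rw [hs.zero, Icc_self]; exact continuousOn_singleton x 0
    | succ k ih =>
      rw [← Icc_union_Icc_eq_Icc (hs.nonneg k) (hs.lt_succ k).le]
      exact ih.union_of_isClosed (fun u hu => (hx k u hu).continuousWithinAt) isClosed_Icc
        isClosed_Icc
  refine ⟨hx0, fun b hb => ?_, ?_⟩
  · obtain ⟨k, hk⟩ := (ht.eventually_ge_atTop b).exists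
    have hcb : ContinuousOn x (Icc 0 b) := (hc k).mono (Icc_subset_Icc_right hk)
    have hbound : ∀ i, ∃ C, ∀ u ∈ Icc 0 b, ‖f i (x u)‖ ≤ C := fun i =>
      isCompact_Icc.exists_bound_of_continuousOn
        ((hf.locallyLipschitz i).continuous.comp_continuousOn hcb)
    choose C hC using hbound
    -- Finitely many modes allow one speed bound; with right derivatives everywhere it makes x
    -- Lipschitz, hence absolutely continuous.
    have hC' : ∀ i, ∀ u ∈ Icc 0 b, ‖f i (x u)‖ ≤ ∑ j, |C j| := fun i u hu =>
      ((hC i u hu).trans (le_abs_self _)).trans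
        (Finset.single_le_sum (f := fun j => |C j|) (fun j _ => abs_nonneg _) (Finset.mem_univ i))
    have hder : ∀ u ∈ Ico 0 b, HasDerivWithinAt x (f (s u) (x u)) (Ici u) u := fun u hu => by
      obtain ⟨l, hl⟩ := hs.exists_mem_Ico ht hu.1
      rw [hs.const l u hl]
      exact hasDerivWithinAt_Ici_of_Icc hl (hx l u (Ico_subset_Icc_self hl))
    refine LipschitzOnWith.absolutelyContinuousOnInterval (K := (∑ j, |C j|).toNNReal) ?_
    rw [uIcc_of_le hb.le]
    refine LipschitzOnWith.of_dist_le_mul fun u hu v hv => ?_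
    rw [Real.coe_toNNReal _ (Finset.sum_nonneg fun j _ => abs_nonneg _)]
    wlog huv : v ≤ u generalizing u v
    · rw [dist_comm, dist_comm u]
      exact this v hv u hu (not_le.1 huv).le
    rw [dist_eq_norm, Real.dist_eq, abs_of_nonneg (sub_nonneg.2 huv)]
    exact norm_image_sub_le_of_norm_deriv_right_le_segment
      (hcb.mono (Icc_subset_Icc hv.1 hu.2))
      (fun w hw => hder w ⟨hv.1.trans hw.1, hw.2.trans_le hu.2⟩)
      (fun w hw => hC' _ w ⟨hv.1.trans hw.1, hw.2.le.trans hu.2⟩) u (right_mem_Icc.2 huv)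
  · rw [ae_restrict_iff' measurableSet_Ioi]
    -- A two-sided derivative can fail only at the countably many switching instants.
    have hne : ∀ᵐ u : ℝ, u ∉ range t := (countable_range t).ae_notMem _
    filter_upwards [hne] with u hu hu0
    obtain ⟨k, hk⟩ := hs.exists_mem_Ico ht (le_of_lt hu0)
    rw [hs.const k u hk]
    exact (hx k u (Ico_subset_Icc_self hk)).hasDerivAt
      (Icc_mem_nhds (lt_of_le_of_ne hk.1 fun h => hu ⟨k, h⟩) hk.2)

/-- Each mode's solution Φ k lives on a whole holding interval; its endpoint value is the next
initial state, and the pieces are glued. Since t k → ∞, they cover [0, ∞). -/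
theorem exists_isSolution (hf : IsSubsystemFamily f) (hV : IsLyapunovFamily f V α₁ α₂ μ lam)
    (hs : IsSwitchingPath s t) (ht : Tendsto t atTop atTop) (x₀ : State n) :
    ∃ x, IsSolution f s x₀ x := by
  classical
  have hloc : ∀ (k : ℕ) (y : State n), ∃ x : ℝ → State n, x (t k) = y ∧
      ∀ u ∈ Icc (t k) (t (k + 1)),
        HasDerivWithinAt x (f (s (t k)) (x u)) (Icc (t k) (t (k + 1))) u := fun k y =>
    exists_hasDerivWithinAt_of_lyapunov (hf.locallyLipschitz _) (hV.differentiable _)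
      (hV.nonneg _) hV.classKInf_lower (hV.lower_bound _) (hV.lieDeriv_le _) y (hs.lt_succ k).le
  choose Φ hΦ0 hΦ using hloc
  let y : ℕ → State n := fun k => Nat.rec x₀ (fun k z => Φ k z (t (k + 1))) k
  have hy : ∀ k, y (k + 1) = Φ k (y k) (t (k + 1)) := fun k => rfl
  let x : ℝ → State n := fun u =>
    if h : ∃ k, u ∈ Ico (t k) (t (k + 1)) then Φ h.choose (y h.choose) u else 0
  have hxΦ : ∀ k, ∀ u ∈ Ico (t k) (t (k + 1)), x u = Φ k (y k) u := fun k u hu => by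
    have h : ∃ k, u ∈ Ico (t k) (t (k + 1)) := ⟨k, hu⟩
    simp only [x, dif_pos h, hs.eq_of_mem_Ico h.choose_spec hu]
  have hxt : ∀ k, x (t k) = y k := fun k => by
    rw [hxΦ k (t k) ⟨le_rfl, hs.lt_succ k⟩, hΦ0]
  have hxI : ∀ k, ∀ u ∈ Icc (t k) (t (k + 1)), x u = Φ k (y k) u := fun k u hu => by
    rcases hu.2.lt_or_eq with h | h
    · exact hxΦ k u ⟨hu.1, h⟩
    · rw [h, hxt, hy]
  refine ⟨x, isSolution_of_hasDerivWithinAt hf hs ht ?_ fun k u hu => ?_⟩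
  · rw [← hs.zero, hxt]; rfl
  · rw [hxI k u hu]
    exact (hΦ k (y k) u hu).congr (hxI k) (hxI k u hu)

theorem IsSolution.eqOn (hf : IsSubsystemFamily f) (hs : IsSwitchingPath s t)
    (ht : Tendsto t atTop atTop) {x₀ : State n} {x y : ℝ → State n} (hx : IsSolution f s x₀ x)
    (hy : IsSolution f s x₀ y) : EqOn y x (Ici 0) := by
  have hI : ∀ k, y (t k) = x (t k) → EqOn y x (Icc (t k) (t (k + 1))) := fun k hk =>
    eqOn_Icc_of_hasDerivWithinAt (hf.locallyLipschitz _) (hy.hasDerivWithinAt hf hs k)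
      (hx.hasDerivWithinAt hf hs k) hk
  have hk : ∀ k, y (t k) = x (t k) := fun k => by
    induction k with
    | zero => rw [hs.zero, hx.initial, hy.initial]
    | succ k ih => exact hI k ih (right_mem_Icc.2 (hs.lt_succ k).le)
  intro u hu
  obtain ⟨k, hku⟩ := hs.exists_mem_Ico ht hu
  exact hI k (hk k) (Ico_subset_Icc_self hku)

/-! ### Growth factors and pathwise stability -/

/-- The factor by which the Lyapunov functions can grow up to the `k`-th switching instant. -/
def growthFactor (s : ℝ → Fin N) (t : ℕ → ℝ) (μ : ℝ) (lam : Fin N → ℝ) (k : ℕ) : ℝ :=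
  ∏ j ∈ Finset.range k, μ * Real.exp (-lam (s (t j)) * (t (j + 1) - t j))

theorem growthFactor_nonneg (hμ : 0 ≤ μ) (k : ℕ) : 0 ≤ growthFactor s t μ lam k :=
  Finset.prod_nonneg fun _ _ => mul_nonneg hμ (Real.exp_pos _).le

theorem IsSolution.lyapunov_le (hf : IsSubsystemFamily f)
    (hV : IsLyapunovFamily f V α₁ α₂ μ lam) (hs : IsSwitchingPath s t) {x₀ : State n}
    {x : ℝ → State n} (hx : IsSolution f s x₀ x) {k : ℕ} {u : ℝ}
    (hu : u ∈ Icc (t k) (t (k + 1))) :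
    V (s (t k)) (x u) ≤ Real.exp (-lam (s (t k)) * (u - t k)) * V (s (t k)) (x (t k)) :=
  lyapunov_le_exp_mul (hV.differentiable _) (hV.lieDeriv_le _) (hx.hasDerivWithinAt hf hs k) hu

/-- Each holding interval contributes its exponential and the switch ending it contributes μ. The
start costs no μ, since α₂ bounds every V i. -/
theorem IsSolution.lyapunov_switching_le (hf : IsSubsystemFamily f)
    (hV : IsLyapunovFamily f V α₁ α₂ μ lam) (hs : IsSwitchingPath s t) {x₀ : State n}
    {x : ℝ → State n} (hx : IsSolution f s x₀ x) (k : ℕ) :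
    V (s (t k)) (x (t k)) ≤ growthFactor s t μ lam k * α₂ ‖x₀‖ := by
  have hμ : 0 ≤ μ := zero_le_one.trans hV.one_lt.le
  induction k with
  | zero =>
    simp only [growthFactor, Finset.range_zero, Finset.prod_empty, one_mul]
    rw [hs.zero, hx.initial]
    exact hV.upper_bound _ _
  | succ k ih =>
    calc V (s (t (k + 1))) (x (t (k + 1))) ≤ μ * V (s (t k)) (x (t (k + 1))) :=
          hV.comparable _ _ _
      _ ≤ μ * (Real.exp (-lam (s (t k)) * (t (k + 1) - t k)) *
            (growthFactor s t μ lam k * α₂ ‖x₀‖)) :=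
          mul_le_mul_of_nonneg_left ((hx.lyapunov_le hf hV hs
            (right_mem_Icc.2 (hs.lt_succ k).le)).trans
            (mul_le_mul_of_nonneg_left ih (Real.exp_pos _).le)) hμ
      _ = _ := by rw [growthFactor, growthFactor, Finset.prod_range_succ]; ring

/-- Rates may be negative, so V can rise between switches; as the elapsed time is at most T, this
overshoot is at most exp((∑|lam i|) T), independently of k. -/
theorem IsSolution.norm_bound (hf : IsSubsystemFamily f)
    (hV : IsLyapunovFamily f V α₁ α₂ μ lam) (hs : IsSwitchingPath s t) {T : ℝ}
    (hT : ∀ k, t (k + 1) - t k ≤ T) {x₀ : State n}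
    {x : ℝ → State n} (hx : IsSolution f s x₀ x) {k : ℕ} {u : ℝ}
    (hu : u ∈ Icc (t k) (t (k + 1))) :
    α₁ ‖x u‖ ≤ Real.exp ((∑ i, |lam i|) * T) * growthFactor s t μ lam k * α₂ ‖x₀‖ := by
  have hμ : 0 ≤ μ := zero_le_one.trans hV.one_lt.le
  refine (hV.lower_bound (s (t k)) _).trans ((hx.lyapunov_le hf hV hs hu).trans ?_)
  rw [mul_assoc]
  refine mul_le_mul (Real.exp_le_exp.2 ?_) (hx.lyapunov_switching_le hf hV hs k) (hV.nonneg _ _)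
    (Real.exp_pos _).le
  have h1 : -lam (s (t k)) ≤ ∑ i, |lam i| := (neg_le_abs _).trans
    (Finset.single_le_sum (f := fun i => |lam i|) (fun i _ => abs_nonneg _) (Finset.mem_univ _))
  exact mul_le_mul h1 (by linarith [hT k, hu.2]) (sub_nonneg.2 hu.1)
    (Finset.sum_nonneg fun i _ => abs_nonneg _)

/-- A pointwise bound passes to the supremum only non-strictly; the margin ε / 2 restores
strictness. -/
theorem iSup_enorm_lt_ofReal {E : Type*} [SeminormedAddCommGroup E] {x : ℝ → E} {A : Set ℝ}
    {ε : ℝ} (hε : 0 < ε) (h : ∀ u ∈ A, ‖x u‖ ≤ ε / 2) :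
    (⨆ u ∈ A, ‖x u‖ₑ) < ENNReal.ofReal ε := by
  refine lt_of_le_of_lt (iSup₂_le fun u hu => ?_)
    ((ENNReal.ofReal_lt_ofReal_iff hε).2 (half_lt_self hε))
  rw [← ofReal_norm]
  exact ENNReal.ofReal_le_ofReal (h u hu)

theorem ClassKInf.norm_le_of_le {α : ℝ → ℝ} (hα : ClassKInf α) {a b : ℝ} (ha : 0 ≤ a)
    (hb : 0 ≤ b) (h : α a ≤ α b) : a ≤ b :=
  (hα.strictMonoOn.le_iff_le ha hb).1 h

theorem ClassKInf.pos {α : ℝ → ℝ} (hα : ClassKInf α) {r : ℝ} (hr : 0 < r) : 0 < α r := by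
  rw [← hα.map_zero]
  exact hα.strictMonoOn self_mem_Ici hr.le hr

theorem ClassKInf.exists_mul_lt {α : ℝ → ℝ} (hα : ClassKInf α) (K : ℝ) {η : ℝ} (hη : 0 < η) :
    ∃ δ, 0 < δ ∧ K * α δ < η := by
  have h1 : Tendsto (fun r => K * α r) (𝓝[>] 0) (𝓝 0) := by
    have h2 : Tendsto α (𝓝[>] 0) (𝓝 (α 0)) :=
      (hα.continuousOn 0 self_mem_Ici).mono_left (nhdsWithin_mono _ Ioi_subset_Ici_self)
    simpa [hα.map_zero] using h2.const_mul K
  obtain ⟨δ, hδ, hδ0⟩ := ((h1.eventually (gt_mem_nhds hη)).and self_mem_nhdsWithin).exists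
  exact ⟨δ, hδ0, hδ⟩

/-- Stability of the system along a switching path with vanishing growth factors. -/
theorem stable_of_growthFactor_tendsto (hf : IsSubsystemFamily f)
    (hV : IsLyapunovFamily f V α₁ α₂ μ lam) (hs : IsSwitchingPath s t)
    (ht : Tendsto t atTop atTop) {T : ℝ} (hT : ∀ k, t (k + 1) - t k ≤ T)
    (hM : Tendsto (growthFactor s t μ lam) atTop (𝓝 0)) {ε : ℝ} (hε : 0 < ε) :
    ∃ δ : ℝ, 0 < δ ∧ ∀ (x₀ : State n) (x : ℝ → State n), IsSolution f s x₀ x → ‖x₀‖ < δ →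
      (⨆ u ∈ Ici (0 : ℝ), ‖x u‖ₑ) < ENNReal.ofReal ε := by
  obtain ⟨B, hB⟩ := hM.bddAbove_range
  obtain ⟨δ, hδ, hδε⟩ := hV.classKInf_upper.exists_mul_lt
    (Real.exp ((∑ i, |lam i|) * T) * B) (hV.classKInf_lower.pos (half_pos hε))
  refine ⟨δ, hδ, fun x₀ x hx hx₀ => iSup_enorm_lt_ofReal hε fun u hu => ?_⟩
  obtain ⟨k, hk⟩ := hs.exists_mem_Ico ht hu
  refine hV.classKInf_lower.norm_le_of_le (norm_nonneg _) (half_pos hε).le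
    ((hx.norm_bound hf hV hs hT (Ico_subset_Icc_self hk)).trans (le_trans ?_ hδε.le))
  have hMB : growthFactor s t μ lam k ≤ B := hB (mem_range_self k)
  have hM0 := growthFactor_nonneg (s := s) (t := t) (lam := lam)
    (zero_le_one.trans hV.one_lt.le) k
  exact mul_le_mul (mul_le_mul_of_nonneg_left hMB (Real.exp_pos _).le)
    (hV.classKInf_upper.strictMonoOn.monotoneOn (norm_nonneg _) hδ.le hx₀.le)
    (hV.classKInf_upper.nonneg (norm_nonneg _))
    (mul_nonneg (Real.exp_pos _).le (hM0.trans hMB))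

/-- Attractivity of the system along a switching path with vanishing growth factors. -/
theorem attractive_of_growthFactor_tendsto (hf : IsSubsystemFamily f)
    (hV : IsLyapunovFamily f V α₁ α₂ μ lam) (hs : IsSwitchingPath s t)
    (ht : Tendsto t atTop atTop) {T : ℝ} (hT : ∀ k, t (k + 1) - t k ≤ T)
    (hM : Tendsto (growthFactor s t μ lam) atTop (𝓝 0)) {r ε : ℝ} (hr : 0 < r) (hε : 0 < ε) :
    ∃ T' : ℝ, 0 ≤ T' ∧ ∀ (x₀ : State n) (x : ℝ → State n), IsSolution f s x₀ x → ‖x₀‖ < r →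
      (⨆ u ∈ Ici T', ‖x u‖ₑ) < ENNReal.ofReal ε := by
  have hlim : Tendsto (fun k => Real.exp ((∑ i, |lam i|) * T) * growthFactor s t μ lam k * α₂ r)
      atTop (𝓝 0) := by simpa using (hM.const_mul _).mul_const (α₂ r)
  obtain ⟨K, hK⟩ := eventually_atTop.1
    (hlim.eventually (gt_mem_nhds (hV.classKInf_lower.pos (half_pos hε))))
  -- K depends on r and ε but not on x₀, so this time serves the whole ball.
  refine ⟨t K, hs.nonneg K, fun x₀ x hx hx₀ => iSup_enorm_lt_ofReal hε fun u hu => ?_⟩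
  obtain ⟨k, hk⟩ := hs.exists_mem_Ico ht ((hs.nonneg K).trans hu)
  have hKk : K ≤ k :=
    Nat.lt_succ_iff.1 (hs.strictMono.lt_iff_lt.1 (lt_of_le_of_lt (mem_Ici.1 hu) hk.2))
  refine hV.classKInf_lower.norm_le_of_le (norm_nonneg _) (half_pos hε).le
    ((hx.norm_bound hf hV hs hT (Ico_subset_Icc_self hk)).trans (le_trans ?_ (hK k hKk).le))
  exact mul_le_mul_of_nonneg_left
    (hV.classKInf_upper.strictMonoOn.monotoneOn (norm_nonneg _) hr.le hx₀.le)
    (mul_nonneg (Real.exp_pos _).le (growthFactor_nonneg (zero_le_one.trans hV.one_lt.le) k))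

end Path

variable {Ω : Type*} [MeasurableSpace Ω]

/-! ### Laplace transforms, independence and almost sure convergence -/

section Probability

variable {N : ℕ} {P : Measure Ω}

theorem integral_exp_neg_mul (l : ℝ) {T : ℝ} (hT : 0 < T) :
    ∫ u in (0 : ℝ)..T, Real.exp (-l * u) = T * expRatio (l * T) := by
  rcases eq_or_ne l 0 with rfl | hl
  · simp [expRatio]
  · rw [intervalIntegral.integral_comp_mul_left (fun u => Real.exp u) (neg_ne_zero.2 hl),
      integral_exp, expRatio, if_neg (mul_ne_zero hl hT.ne')]
    simp only [mul_zero, Real.exp_zero, smul_eq_mul, neg_mul]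
    field_simp
    ring

theorem expRatio_nonneg (a : ℝ) : 0 ≤ expRatio a := by
  rw [expRatio]
  split_ifs with h
  · exact zero_le_one
  · rcases lt_or_gt_of_ne h with h | h
    · exact div_nonneg_of_nonpos (by
        have : 1 ≤ Real.exp (-a) := Real.one_le_exp (by linarith)
        linarith) h.le
    · exact div_nonneg (by
        have : Real.exp (-a) ≤ 1 := Real.exp_le_one_iff.2 (by linarith)
        linarith) h.le

theorem expRatio_lt_one {a : ℝ} (ha : 0 < a) : expRatio a < 1 := by
  rw [expRatio, if_neg ha.ne', div_lt_one ha]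
  have := Real.add_one_lt_exp (neg_ne_zero.2 ha.ne')
  linarith

/-- The Laplace transform of the uniform distribution on `[0, T]`. -/
theorem lintegral_exp_of_isUniform {S : Ω → ℝ} (hSm : Measurable S) {T : ℝ} (hT : 0 < T)
    (hS : pdf.IsUniform S (Icc 0 T) P) {c : ℝ} (hc : 0 ≤ c) (l : ℝ) :
    ∫⁻ ω, ENNReal.ofReal (c * Real.exp (-l * S ω)) ∂P =
      ENNReal.ofReal (c * expRatio (l * T)) := by
  have hm : Measurable fun u : ℝ => ENNReal.ofReal (c * Real.exp (-l * u)) := by fun_prop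
  have hcont : Continuous fun u : ℝ => c * Real.exp (-l * u) := by fun_prop
  rw [← lintegral_map (f := fun u : ℝ => ENNReal.ofReal (c * Real.exp (-l * u))) hm hSm, hS,
    ProbabilityTheory.cond, lintegral_smul_measure,
    ← ofReal_integral_eq_lintegral_ofReal (hcont.integrableOn_Icc)
      (ae_of_all _ fun u => mul_nonneg hc (Real.exp_pos _).le),
    integral_Icc_eq_integral_Ioc, ← intervalIntegral.integral_of_le hT.le,
    intervalIntegral.integral_const_mul, integral_exp_neg_mul l hT, Real.volume_Icc, sub_zero,
    smul_eq_mul, ← ENNReal.ofReal_inv_of_pos hT, ← ENNReal.ofReal_mul (inv_nonneg.2 hT.le)]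
  congr 1
  field_simp

/-- The expectation of a product of functions of two independent sequences, the second of which is
itself independent. -/
theorem lintegral_prod_of_indepFun [IsProbabilityMeasure P] {D : ℕ → Ω → Fin N} {S : ℕ → Ω → ℝ}
    (hD : ∀ j, Measurable (D j)) (hS : ∀ j, Measurable (S j)) (hi : iIndepFun S P)
    (hind : IndepFun (fun ω j => S j ω) (fun ω j => D j ω) P) {h : Fin N → ℝ → ℝ≥0∞}
    (hh : ∀ i, Measurable (h i)) {a : Fin N → ℝ≥0∞}
    (ha : ∀ i j, ∫⁻ ω, h i (S j ω) ∂P = a i) (k : ℕ) :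
    ∫⁻ ω, ∏ j ∈ Finset.range k, h (D j ω) (S j ω) ∂P =
      ∫⁻ ω, ∏ j ∈ Finset.range k, a (D j ω) ∂P := by
  have hDm : Measurable fun ω j => D j ω := measurable_pi_lambda _ hD
  have hSm : Measurable fun ω j => S j ω := measurable_pi_lambda _ hS
  have hh2 : Measurable fun p : Fin N × ℝ => h p.1 p.2 := measurable_from_prod_countable_right hh
  have hF : Measurable fun p : (ℕ → Fin N) × (ℕ → ℝ) =>
      ∏ j ∈ Finset.range k, h (p.1 j) (p.2 j) :=
    Finset.measurable_fun_prod _ fun j _ => by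
      have hj : Measurable fun p : (ℕ → Fin N) × (ℕ → ℝ) => (p.1 j, p.2 j) := by fun_prop
      exact hh2.comp hj
  have hlaw := (indepFun_iff_map_prod_eq_prod_map_map hDm.aemeasurable hSm.aemeasurable).1
    hind.symm
  -- The joint law is a product, so by Tonelli the destinations can be frozen while the holding
  -- times are integrated.
  have h1 := lintegral_map (μ := P) hF (hDm.prodMk hSm)
  rw [hlaw, lintegral_prod _ hF.aemeasurable, lintegral_map hF.lintegral_prod_right' hDm] at h1
  rw [← h1]
  refine lintegral_congr fun ω => ?_
  refine (lintegral_map (hF.comp measurable_prodMk_left) hSm).trans ?_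
  refine (lintegral_prod_eq_prod_lintegral_of_indepFun (Finset.range k)
    (fun j ω' => h (D j ω) (S j ω')) (hi.comp (fun j => h (D j ω)) fun j => hh _)
    fun j => (hh _).comp (hS j)).trans ?_
  exact Finset.prod_congr rfl fun j _ => ha _ _

/-- If the conditional distribution of a random variable given `m` is constant, then expectations
of products with `m`-measurable bounded factors split. -/
theorem integral_mul_of_condExp_const {Ω : Type*} {m mΩ : MeasurableSpace Ω} {P : Measure Ω}
    [IsProbabilityMeasure P] (hm : m ≤ mΩ) {D : Ω → Fin N} (hD : Measurable D) {q : Fin N → ℝ}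
    (hq : ∀ i, P⟦D ⁻¹' {i} | m⟧ =ᵐ[P] fun _ => q i) {X : Ω → ℝ} (hX : StronglyMeasurable[m] X)
    {C : ℝ} (hXC : ∀ ω, ‖X ω‖ ≤ C) (a : Fin N → ℝ) :
    ∫ ω, X ω * a (D ω) ∂P = (∑ i, a i * q i) * ∫ ω, X ω ∂P := by
  have hind : ∀ i, Integrable ((D ⁻¹' {i}).indicator fun _ => (1 : ℝ)) P := fun i =>
    (integrable_const 1).indicator (hD (measurableSet_singleton i))
  have hXm : AEStronglyMeasurable X P := (hX.mono hm).aestronglyMeasurable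
  have hi : ∀ i, ∫ ω, X ω * (D ⁻¹' {i}).indicator (fun _ => (1 : ℝ)) ω ∂P
      = q i * ∫ ω, X ω ∂P := fun i => by
    have h1 := condExp_stronglyMeasurable_mul_of_bound hm hX (hind i) C (ae_of_all _ hXC)
    calc ∫ ω, X ω * (D ⁻¹' {i}).indicator (fun _ => (1 : ℝ)) ω ∂P
        = ∫ ω, (P[X * (D ⁻¹' {i}).indicator (fun _ => (1 : ℝ)) | m]) ω ∂P :=
          (integral_condExp hm).symm
      _ = ∫ ω, q i * X ω ∂P := integral_congr_ae (by
          filter_upwards [h1, hq i] with ω h2 h3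
          rw [h2, Pi.mul_apply, h3, mul_comm])
      _ = _ := integral_const_mul _ _
  -- As D takes finitely many values, a ∘ D is a combination of indicators, to each of which the
  -- pull-out property applies.
  have hsum : ∀ ω, X ω * a (D ω) =
      ∑ i, a i * (X ω * (D ⁻¹' {i}).indicator (fun _ => (1 : ℝ)) ω) := fun ω => by
    rw [Finset.sum_eq_single (D ω)]
    · simp [mul_comm]
    · intro i _ hi'
      rw [indicator_of_notMem (by simpa using hi'.symm)]
      simp
    · simp
  simp_rw [hsum]
  rw [integral_finsetSum _ fun i _ => ((hind i).bdd_mul hXm (ae_of_all _ hXC)).const_mul _,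
    Finset.sum_mul]
  refine Finset.sum_congr rfl fun i _ => ?_
  rw [integral_const_mul, hi, mul_assoc]

/-- Nonnegative random variables whose expectations decay geometrically tend to zero almost
surely. -/
theorem ae_tendsto_zero_of_lintegral_le_geometric {M : ℕ → Ω → ℝ} (hM : ∀ k, Measurable (M k))
    (hM0 : ∀ k ω, 0 ≤ M k ω) {C θ : ℝ} (hθ0 : 0 ≤ θ) (hθ : θ < 1) (hC : 0 ≤ C)
    (h : ∀ k, ∫⁻ ω, ENNReal.ofReal (M (k + 1) ω) ∂P ≤ ENNReal.ofReal (C * θ ^ k)) :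
    ∀ᵐ ω ∂P, Tendsto (fun k => M k ω) atTop (𝓝 0) := by
  have hfin : ∫⁻ ω, ∑' k, ENNReal.ofReal (M (k + 1) ω) ∂P ≠ ∞ := by
    rw [lintegral_tsum fun k => (hM (k + 1)).ennreal_ofReal.aemeasurable]
    refine ne_top_of_le_ne_top ?_ (ENNReal.tsum_le_tsum h)
    rw [← ENNReal.ofReal_tsum_of_nonneg (fun k => mul_nonneg hC (pow_nonneg hθ0 k))
      ((summable_geometric_of_lt_one hθ0 hθ).mul_left C)]
    exact ENNReal.ofReal_ne_top
  filter_upwards [ae_lt_top' (by fun_prop) hfin] with ω hω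
  have h1 := (ENNReal.tendsto_toReal ENNReal.zero_ne_top).comp
    (ENNReal.tendsto_atTop_zero_of_tsum_ne_top hω.ne)
  refine (tendsto_add_atTop_iff_nat 1).1 (h1.congr fun k => ?_)
  exact ENNReal.toReal_ofReal (hM0 (k + 1) ω)

end Probability

/-! ### Almost sure behaviour of the switching signal -/

section Signal

variable {N : ℕ} {P : Measure Ω} {σ : ℝ → Ω → Fin N} {τ : ℕ → Ω → ℝ} {T : ℝ} {q : Fin N → ℝ}

theorem IsSwitchingSignal.measurable_holdingTime (hσ : IsSwitchingSignal P σ τ) (j : ℕ) :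
    Measurable (holdingTime τ j) :=
  (hσ.measurable_times (j + 1)).sub (hσ.measurable_times j)

theorem exists_bound_prod {Ω : Type*} (a : Fin N → ℝ) (D : ℕ → Ω → Fin N) (k : ℕ) :
    ∃ C, ∀ ω, ‖∏ j ∈ Finset.range k, a (D j ω)‖ ≤ C := by
  refine ⟨∏ _j ∈ Finset.range k, ∑ i, ‖a i‖, fun ω => ?_⟩
  rw [norm_prod]
  exact Finset.prod_le_prod (fun _ _ => norm_nonneg _) fun j _ =>
    Finset.single_le_sum (f := fun i => ‖a i‖) (fun _ _ => norm_nonneg _) (Finset.mem_univ _)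

/-- Conditioning on the past integrates out the last factor, giving `∑ i, a i * q i`. The
destination at time 0 need not have law q, so its mean stays separate and k + 1 factors yield only
the power k. -/
theorem ClassUH.integral_prod_destination [IsProbabilityMeasure P]
    (hσ : IsSwitchingSignal P σ τ) (hUH : ClassUH P σ τ T q) (a : Fin N → ℝ) (k : ℕ) :
    ∫ ω, ∏ j ∈ Finset.range (k + 1), a (destination σ τ j ω) ∂P =
      (∫ ω, a (destination σ τ 0 ω) ∂P) * (∑ i, a i * q i) ^ k := by
  induction k with
  | zero => simp
  | succ k ih =>
    obtain ⟨C, hC⟩ := exists_bound_prod a (destination σ τ) (k + 1)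
    have hpast : Measurable fun ω (j : Fin (k + 1)) => destination σ τ j ω :=
      measurable_pi_lambda _ fun j => hσ.measurable_destination j
    have hX : StronglyMeasurable[MeasurableSpace.comap
        (fun ω (j : Fin (k + 1)) => destination σ τ j ω) inferInstance]
        fun ω => ∏ j ∈ Finset.range (k + 1), a (destination σ τ j ω) := by
      have hg : Measurable fun d : Fin (k + 1) → Fin N => ∏ j, a (d j) :=
        Finset.measurable_fun_prod _ fun j _ =>
          (Measurable.of_discrete (f := a)).comp (measurable_pi_apply j)
      refine Measurable.stronglyMeasurable ?_
      simp_rw [Finset.prod_range fun j => a (destination σ τ j _)]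
      exact hg.comp (comap_measurable _)
    simp_rw [Finset.prod_range_succ _ (k + 1)]
    rw [integral_mul_of_condExp_const hpast.comap_le (hσ.measurable_destination (k + 1))
      (hUH.condProb (k + 1) (by omega)) hX hC a, ih]
    ring

/-- Products of exponentials of holding times vanish almost surely if their mean factor is less
than one. -/
theorem ClassUH.ae_tendsto_prod_exp [IsProbabilityMeasure P]
    (hσ : IsSwitchingSignal P σ τ) (hUH : ClassUH P σ τ T q) {c : ℝ} (hc : 0 ≤ c)
    (lam : Fin N → ℝ) (hsum : ∑ i, c * expRatio (lam i * T) * q i < 1) :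
    ∀ᵐ ω ∂P, Tendsto (fun k => ∏ j ∈ Finset.range k,
      c * Real.exp (-lam (destination σ τ j ω) * holdingTime τ j ω)) atTop (𝓝 0) := by
  have ha : ∀ i, 0 ≤ c * expRatio (lam i * T) := fun i => mul_nonneg hc (expRatio_nonneg _)
  have hfac : ∀ j ω, 0 ≤ c * Real.exp (-lam (destination σ τ j ω) * holdingTime τ j ω) :=
    fun j ω => mul_nonneg hc (Real.exp_pos _).le
  have hlam : ∀ j, Measurable fun ω => lam (destination σ τ j ω) := fun j =>
    (Measurable.of_discrete (f := lam)).comp (hσ.measurable_destination j)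
  have hS := hσ.measurable_holdingTime
  refine ae_tendsto_zero_of_lintegral_le_geometric
    (C := ∫ ω, c * expRatio (lam (destination σ τ 0 ω) * T) ∂P)
    (θ := ∑ i, c * expRatio (lam i * T) * q i)
    (fun k => Finset.measurable_fun_prod _ fun j _ => ?_)
    (fun k ω => Finset.prod_nonneg fun j _ => hfac j ω)
    (Finset.sum_nonneg fun i _ => mul_nonneg (ha i) (hUH.mem_Icc i).1) hsum
    (integral_nonneg fun ω => ha _) fun k => ?_
  · exact (Real.measurable_exp.comp ((hlam j).neg.mul (hS j))).const_mul c
  · simp_rw [ENNReal.ofReal_prod_of_nonneg fun j _ => hfac j _]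
    rw [lintegral_prod_of_indepFun hσ.measurable_destination hS hUH.indep_times hUH.indep
      (h := fun i u => ENNReal.ofReal (c * Real.exp (-lam i * u))) (fun i => by fun_prop)
      (a := fun i => ENNReal.ofReal (c * expRatio (lam i * T)))
      (fun i j => lintegral_exp_of_isUniform (hS j) hUH.pos (hUH.uniform j) hc (lam i)) (k + 1)]
    simp_rw [← ENNReal.ofReal_prod_of_nonneg fun j _ => ha (destination σ τ j _)]
    obtain ⟨C, hC⟩ := exists_bound_prod (fun i => c * expRatio (lam i * T)) (destination σ τ)
      (k + 1)
    have hm : Measurable fun ω =>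
        ∏ j ∈ Finset.range (k + 1), c * expRatio (lam (destination σ τ j ω) * T) :=
      Finset.measurable_fun_prod _ fun j _ =>
        (Measurable.of_discrete (f := fun i => c * expRatio (lam i * T))).comp
          (hσ.measurable_destination j)
    rw [← ofReal_integral_eq_lintegral_ofReal
      (Integrable.of_bound hm.aestronglyMeasurable C (ae_of_all _ hC))
      (ae_of_all _ fun ω => Finset.prod_nonneg fun j _ => ha _),
      hUH.integral_prod_destination hσ (fun i => c * expRatio (lam i * T)) k]

/-- The conditional distribution of the destinations has total mass one. -/
theorem ClassUH.sum_eq_one [IsProbabilityMeasure P] (hσ : IsSwitchingSignal P σ τ)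
    (hUH : ClassUH P σ τ T q) : ∑ i, q i = 1 := by
  -- With a = 1 and k = 1 the left side is 1 and the right side is the total mass of q.
  simpa using (hUH.integral_prod_destination hσ (fun _ => 1) 1).symm

/-- Almost surely, the switching instants do not accumulate. -/
theorem ClassUH.ae_tendsto_times [IsProbabilityMeasure P] (hσ : IsSwitchingSignal P σ τ)
    (hUH : ClassUH P σ τ T q) : ∀ᵐ ω ∂P, Tendsto (fun k => τ k ω) atTop atTop := by
  -- With factor 1 and all rates 1, the product of exponentials telescopes to exp(-τ_k); its mean
  -- factor is `expRatio T < 1`.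
  have hlt : ∑ i, 1 * expRatio ((fun _ => 1 : Fin N → ℝ) i * T) * q i < 1 := by
    rw [← Finset.mul_sum, hUH.sum_eq_one hσ]
    simpa using expRatio_lt_one hUH.pos
  filter_upwards [hUH.ae_tendsto_prod_exp hσ zero_le_one (fun _ => 1) hlt, hσ.paths]
    with ω hω hpath
  have hprod : ∀ k, ∏ j ∈ Finset.range k, 1 * Real.exp (-1 * holdingTime τ j ω) =
      Real.exp (-τ k ω) := fun k => by
    simp only [one_mul, neg_mul]
    rw [← Real.exp_sum, Finset.sum_neg_distrib]
    simp only [holdingTime]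
    rw [Finset.sum_range_sub (fun j => τ j ω), show τ 0 ω = 0 from hpath.zero, sub_zero]
  have h1 : Tendsto (fun k => -τ k ω) atTop atBot :=
    Real.tendsto_exp_comp_nhds_zero.1 (hω.congr hprod)
  simpa [Function.comp_def] using tendsto_neg_atBot_atTop.comp h1

theorem ClassUH.ae_holdingTime_le (hσ : IsSwitchingSignal P σ τ) (hUH : ClassUH P σ τ T q) :
    ∀ᵐ ω ∂P, ∀ j, τ (j + 1) ω - τ j ω ≤ T := by
  rw [ae_all_iff]
  intro j
  have hu := hUH.uniform j
  have h1 : ∀ᵐ u ∂(P.map (holdingTime τ j)), u ∈ Icc 0 T := by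
    rw [hu]
    exact ae_cond_mem measurableSet_Icc
  filter_upwards [ae_of_ae_map (hσ.measurable_holdingTime j).aemeasurable h1] with ω hω
  exact hω.2

end Signal

end SwitchedSystem

end

theorem mainTheorem2 {n N : ℕ} {Ω : Type*} [MeasurableSpace Ω]
    (P : Measure Ω) [IsProbabilityMeasure P]
    (f : Fin N → SwitchedSystem.State n → SwitchedSystem.State n)
    (hf : SwitchedSystem.IsSubsystemFamily f)
    (σ : ℝ → Ω → Fin N) (τ : ℕ → Ω → ℝ) (hσ : SwitchedSystem.IsSwitchingSignal P σ τ)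
    (V : Fin N → SwitchedSystem.State n → ℝ) (α₁ α₂ : ℝ → ℝ) (μ : ℝ) (lam : Fin N → ℝ)
    (hV : SwitchedSystem.IsLyapunovFamily f V α₁ α₂ μ lam)
    (T : ℝ) (q : Fin N → ℝ) (hUH : SwitchedSystem.ClassUH P σ τ T q)
    (hsum : ∑ i, μ * q i * SwitchedSystem.expRatio (lam i * T) < 1) :
    SwitchedSystem.WellPosedAS P f σ ∧ SwitchedSystem.GASAlmostSurely P f σ := by
  have htimes := hUH.ae_tendsto_times hσ
  have hholding := hUH.ae_holdingTime_le hσ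
  have hgrowth : ∀ᵐ ω ∂P, Tendsto
      (SwitchedSystem.growthFactor (fun u => σ u ω) (fun k => τ k ω) μ lam) atTop (𝓝 0) :=
    hUH.ae_tendsto_prod_exp hσ (zero_le_one.trans hV.one_lt.le) lam
      (by simpa only [mul_right_comm] using hsum)
  refine ⟨?_, ?_, ?_⟩
  · filter_upwards [hσ.paths, htimes] with ω hs ht x₀
    obtain ⟨x, hx⟩ := SwitchedSystem.exists_isSolution hf hV hs ht x₀
    exact ⟨x, hx, fun y hy => hx.eqOn hf hs ht hy⟩
  · filter_upwards [hσ.paths, htimes, hholding, hgrowth] with ω hs ht hT hM ε hε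
    exact SwitchedSystem.stable_of_growthFactor_tendsto hf hV hs ht hT hM hε
  · filter_upwards [hσ.paths, htimes, hholding, hgrowth] with ω hs ht hT hM r ε hr hε
    exact SwitchedSystem.attractive_of_growthFactor_tendsto hf hV hs ht hT hM hr hε
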